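/- Let $K\in\mathbb{N}$ and let $\theta_1,\theta_2$ be two probability distributions (policies) on the action set $[K]=\{1,\dots,K\}$, known to the player. For a horizon $T\in\mathbb{N}$, let $(\ell_t)_{t=1}^T$ be a fixed sequence of loss vectors, unknown to the player, with $\ell_t(j)\in[0,1]$ for $j\in[K]$. In each round $t=1,\dots,T$, the player selects, possibly at random, a policy $\xi_t\in\Theta=\{\theta_1,\theta_2\}$; an action $A_t$ is then drawn from $\xi_t$, and the player observes $(A_t,\ell_t(A_t))$. An algorithm prescribes, for each round, the distribution of the selected policy as a function of the history of all previously selected policies, drawn actions and observed losses. Write $\ell_t(\theta)=\sum_{j=1}^K\theta(j)\ell_t(j)$. The regret of the algorithm on $(\ell_t)_{t=1}^T$ is $$R_T=\mathbb{E}\sum_{t=1}^T\ell_t(\xi_t)-\min_{\theta\in\Theta}\sum_{t=1}^T\ell_t(\theta),$$ where the expectation is over the random policy choices and the drawn actions. Let $H^2(\theta_1,\theta_2)=\frac12\sum_{j=1}^K\big(\sqrt{\theta_1(j)}-\sqrt{\theta_2(j)}\big)^2$ be the squared Hellinger distance, and assume $H^2(\theta_1,\theta_2)>0$. Then, for every $T\ge\frac{1}{8\log(4/3)\,H^2(\theta_1,\theta_2)}$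 and every algorithm, there exists a sequence of losses $(\ell_t)_{t=1}^T$ with values in $[0,1]$ such that $$R_T\ge\frac1{13}\sqrt{H^2(\theta_1,\theta_2)\,T}.$$ -/

import Mathlib

namespace FixedExpertBandit

/-- A policy on `K` actions: a point of the probability simplex in `ℝ^K`. -/
abbrev Policy (K : ℕ) : Type := stdSimplex ℝ (Fin K)

/-- The squared Hellinger distance of two policies,
`H²(p, q) = (1/2) ∑ j, (√(p j) - √(q j))²`. -/
noncomputable def sqHellinger {K : ℕ} (p q : Policy K) : ℝ :=
  (1 / 2) * ∑ j, (√(p j) - √(q j)) ^ 2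

/-- What the player knows after `t` rounds: for each past round the (index of the) selected
policy, the drawn action, and the loss of that action. -/
abbrev History (N K t : ℕ) : Type := Fin t → Fin N × Fin K × ℝ

/-- A (randomized) algorithm for `N` policies on `K` actions: in round `t` (rounds are numbered
from `0`) it draws the index of a policy from a distribution that is an arbitrary function of the
history of the previous `t` rounds. -/
abbrev Algorithm (N K : ℕ) : Type := (t : ℕ) → History N K t → stdSimplex ℝ (Fin N)

variable {N K T : ℕ}

/-- The loss `∑ j, p(j) ℓ(j)` that a policy incurs in expectation on a loss vector. -/
noncomputable def policyLoss (p : Policy K) (l : Fin K → ℝ) : ℝ :=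
  ∑ j, p j * l j

/-- The history that the player has seen before round `t`, when the losses are `ℓ` and `ω` records
the selected policies and the drawn actions. -/
def observed (ℓ : Fin T → Fin K → ℝ) (ω : Fin T → Fin N × Fin K) (t : Fin T) :
    History N K t := fun s =>
  ((ω (Fin.castLE t.2.le s)).1, (ω (Fin.castLE t.2.le s)).2,
    ℓ (Fin.castLE t.2.le s) (ω (Fin.castLE t.2.le s)).2)

/-- The probability that `T` rounds of play produce the policies and actions `ω`: in each round
the algorithm draws a policy given the observed history, then an action is drawn from it. -/
noncomputable def pathProb (Θ : Fin N → Policy K) (alg : Algorithm N K)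
    (ℓ : Fin T → Fin K → ℝ) (ω : Fin T → Fin N × Fin K) : ℝ :=
  ∏ t : Fin T, alg t (observed ℓ ω t) (ω t).1 * Θ (ω t).1 (ω t).2

/-- The regret `𝔼 ∑ t, ℓ_t(θ_t) - min_{θ ∈ Θ} ∑ t, ℓ_t(θ)` of an algorithm on the loss sequence
`ℓ`, the expectation being over the drawn policies and actions. -/
noncomputable def regret [NeZero N] (Θ : Fin N → Policy K) (alg : Algorithm N K)
    (ℓ : Fin T → Fin K → ℝ) : ℝ :=
  (∑ ω : Fin T → Fin N × Fin K, pathProb Θ alg ℓ ω * ∑ t, policyLoss (Θ (ω t).1) (ℓ t))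
    - Finset.univ.inf' Finset.univ_nonempty (fun i : Fin N => ∑ t, policyLoss (Θ i) (ℓ t))

/-- The path probabilities are nonnegative. -/
theorem pathProb_nonneg (Θ : Fin N → Policy K) (alg : Algorithm N K)
    (ℓ : Fin T → Fin K → ℝ) (ω : Fin T → Fin N × Fin K) : 0 ≤ pathProb Θ alg ℓ ω :=
  Finset.prod_nonneg fun _ _ => mul_nonneg ((alg _ _).2.1 _) ((Θ _).2.1 _)

/-- The path probabilities add up to `1`. -/
theorem sum_pathProb (Θ : Fin N → Policy K) (alg : Algorithm N K) :
    ∀ (T : ℕ) (ℓ : Fin T → Fin K → ℝ),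
      ∑ ω : Fin T → Fin N × Fin K, pathProb Θ alg ℓ ω = 1
  | 0, ℓ => by simp [pathProb]
  | T + 1, ℓ => by
    have key : ∀ (x : Fin N × Fin K) (ω : Fin T → Fin N × Fin K),
        pathProb Θ alg ℓ (Fin.snoc ω x : Fin (T + 1) → Fin N × Fin K) =
          pathProb Θ alg (fun t => ℓ t.castSucc) ω *
            (alg T (fun s => ((ω s).1, (ω s).2, ℓ s.castSucc (ω s).2)) x.1 * Θ x.1 x.2) := by
      intro x ω
      have hsn : ∀ (n : ℕ) (hn : n ≤ T) (s : Fin n),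
          (Fin.snoc ω x : Fin (T + 1) → Fin N × Fin K) (Fin.castLE (hn.trans T.le_succ) s)
            = ω (Fin.castLE hn s) := fun n hn s =>
        Fin.snoc_castSucc (α := fun _ => Fin N × Fin K) x ω (Fin.castLE hn s)
      unfold pathProb
      rw [Fin.prod_univ_castSucc]
      congr 1
      · refine Finset.prod_congr rfl fun t _ => ?_
        have hobs : observed ℓ (Fin.snoc ω x : Fin (T + 1) → Fin N × Fin K) t.castSucc
            = observed (fun t => ℓ t.castSucc) ω t := by
          funext s
          have := hsn t t.2.le s
          unfold observed
          erw [this]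
          rfl
        rw [Fin.snoc_castSucc, hobs]
        rfl
      · have hobs : observed ℓ (Fin.snoc ω x : Fin (T + 1) → Fin N × Fin K) (Fin.last T)
            = fun s => ((ω s).1, (ω s).2, ℓ s.castSucc (ω s).2) := by
          funext s
          have := hsn T le_rfl s
          unfold observed
          erw [this]
          rfl
        rw [Fin.snoc_last, hobs]
        rfl
    have hone : ∀ ω : Fin T → Fin N × Fin K, ∑ x : Fin N × Fin K,
        alg T (fun s => ((ω s).1, (ω s).2, ℓ s.castSucc (ω s).2)) x.1 * Θ x.1 x.2 = 1 := by
      intro ω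
      have hΘ : ∀ i, ∑ j, Θ i j = 1 := fun i => (Θ i).2.2
      have ha : ∑ i, alg T (fun s => ((ω s).1, (ω s).2, ℓ s.castSucc (ω s).2)) i = 1 :=
        (alg T _).2.2
      rw [Fintype.sum_prod_type]
      simp only [← Finset.mul_sum, hΘ, mul_one, ha]
    rw [← (Fin.snocEquiv fun _ : Fin (T + 1) => Fin N × Fin K).sum_comp, Fintype.sum_prod_type,
      Finset.sum_comm]
    have : ∀ (ω : Fin T → Fin N × Fin K) (x : Fin N × Fin K),
        pathProb Θ alg ℓ ((Fin.snocEquiv fun _ : Fin (T + 1) => Fin N × Fin K) (x, ω)) =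
          pathProb Θ alg (fun t => ℓ t.castSucc) ω *
            (alg T (fun s => ((ω s).1, (ω s).2, ℓ s.castSucc (ω s).2)) x.1 * Θ x.1 x.2) :=
      fun ω x => key x ω
    simp only [this, ← Finset.mul_sum, hone, mul_one]
    exact sum_pathProb Θ alg T _

end FixedExpertBandit

/-! Let `c j = (√(p j) - √(q j)) / (√(p j) + √(q j))` and draw all losses as independent bits with
means `1/2 - δ c` or `1/2 + δ c`. One policy is better in the first environment, the other in the
second, both by `2δH²`; under either policy, one observation distinguishes the environments only by
order `δ²H²`, since `∑ p c² ≤ 2H²`. With `δ` of order `1/√(H²T)` they stay confusable for all `T`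
rounds, so regret of order `δH²T`, that is `√(H²T)`, is unavoidable.

The core is `stochLoss_add_stochLoss_ge`, an induction over weights `α`, `β` that act as an
unnormalised posterior. A round costs at least `g * min α β`, which is bounded below by a
combination of `√(αβ)` and `α + β`. Averaging over an observation preserves `α + β` and shrinks
`√(αβ)` at most by the factor `ρ`, giving a geometric sum. `exists_regret_ge` then extracts a
deterministic sequence. -/

namespace FixedExpertBandit

open Finset

/-! ### Conditioning on the first round. -/

/-- The algorithm that remains once the outcome `z` of the first round is known. -/
def Algorithm.shift {N K : ℕ} (alg : Algorithm N K) (z : Fin N × Fin K × ℝ) : Algorithm N K :=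
  fun t h => alg (t + 1) (Fin.cons z h : Fin (t + 1) → Fin N × Fin K × ℝ)

/-- The expected loss of an algorithm on a loss sequence. -/
noncomputable def expLoss {N K T : ℕ} (Θ : Fin N → Policy K) (alg : Algorithm N K)
    (ℓ : Fin T → Fin K → ℝ) : ℝ :=
  ∑ ω : Fin T → Fin N × Fin K, pathProb Θ alg ℓ ω * ∑ t, policyLoss (Θ (ω t).1) (ℓ t)

theorem pathProb_cons {N K T : ℕ} (Θ : Fin N → Policy K) (alg : Algorithm N K)
    (ℓ : Fin (T + 1) → Fin K → ℝ) (x : Fin N × Fin K) (ω : Fin T → Fin N × Fin K) :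
    pathProb Θ alg ℓ (Fin.cons x ω : Fin (T + 1) → Fin N × Fin K) =
      alg 0 Fin.elim0 x.1 * Θ x.1 x.2 *
        pathProb Θ (alg.shift (x.1, x.2, ℓ 0 x.2)) (fun t => ℓ t.succ) ω := by
  unfold pathProb
  rw [Fin.prod_univ_succ]
  congr 1
  · simp only [Fin.cons_zero]
    congr 2
    exact congrArg (alg 0) (Subsingleton.elim _ _)
  · refine prod_congr rfl fun t _ => ?_
    simp only [Fin.cons_succ]
    congr 2
    have : observed ℓ (Fin.cons x ω : Fin (T + 1) → Fin N × Fin K) t.succ =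
        (Fin.cons (x.1, x.2, ℓ 0 x.2) (observed (fun t => ℓ t.succ) ω t) :
          Fin (t.1 + 1) → Fin N × Fin K × ℝ) := by
      funext s
      refine Fin.cases ?_ (fun s => ?_) s
      · rfl
      · rfl
    rw [this]
    rfl

theorem expLoss_succ {N K T : ℕ} (Θ : Fin N → Policy K) (alg : Algorithm N K)
    (ℓ : Fin (T + 1) → Fin K → ℝ) :
    expLoss Θ alg ℓ = ∑ i, ∑ a, alg 0 Fin.elim0 i * Θ i a *
      (policyLoss (Θ i) (ℓ 0) + expLoss Θ (alg.shift (i, a, ℓ 0 a)) (fun t => ℓ t.succ)) := by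
  unfold expLoss
  rw [← (Fin.consEquiv fun _ : Fin (T + 1) => Fin N × Fin K).sum_comp, Fintype.sum_prod_type,
    Fintype.sum_prod_type]
  refine sum_congr rfl fun i _ => sum_congr rfl fun a _ => ?_
  have h1 := sum_pathProb Θ (alg.shift (i, a, ℓ 0 a)) T (fun t => ℓ t.succ)
  have h2 : ∀ ω : Fin T → Fin N × Fin K,
      pathProb Θ alg ℓ ((Fin.consEquiv fun _ : Fin (T + 1) => Fin N × Fin K) ((i, a), ω)) *
        ∑ t, policyLoss (Θ (((Fin.consEquiv fun _ : Fin (T + 1) => Fin N × Fin K)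
          ((i, a), ω)) t).1) (ℓ t) =
      alg 0 Fin.elim0 i * Θ i a *
        (pathProb Θ (alg.shift (i, a, ℓ 0 a)) (fun t => ℓ t.succ) ω * policyLoss (Θ i) (ℓ 0) +
        pathProb Θ (alg.shift (i, a, ℓ 0 a)) (fun t => ℓ t.succ) ω *
          ∑ t : Fin T, policyLoss (Θ (ω t).1) (ℓ t.succ)) := by
    intro ω
    have := pathProb_cons Θ alg ℓ (i, a) ω
    rw [Fin.sum_univ_succ]
    simp only [Fin.consEquiv, Equiv.coe_fn_mk, Fin.cons_zero, Fin.cons_succ]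
    rw [this]
    ring
  simp only [h2]
  rw [← mul_sum, sum_add_distrib, ← sum_mul, h1, one_mul]

/-! ### Independent Bernoulli losses. -/

/-- The mass of `v` under the Bernoulli law with mean `x`. -/
def bern (x : ℝ) (v : Bool) : ℝ := if v then x else 1 - x

theorem sum_bern (x : ℝ) : ∑ v, bern x v = 1 := by simp [bern]

theorem bern_nonneg {x : ℝ} (hx : x ∈ Set.Icc (0 : ℝ) 1) (v : Bool) : 0 ≤ bern x v := by
  unfold bern
  split
  · exact hx.1
  · linarith [hx.2]

/-- The mass of `y` under the law of independent Bernoulli variables with means `e`. -/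
def bernProd {K : ℕ} (e : Fin K → ℝ) (y : Fin K → Bool) : ℝ := ∏ j, bern (e j) (y j)

/-- The mass of `b` under the law of independent rounds of Bernoulli variables with means `e`. -/
def bernSeq {K n : ℕ} (e : Fin K → ℝ) (b : Fin n → Fin K → Bool) : ℝ := ∏ t, bernProd e (b t)

/-- A bit as a loss. -/
def bitLoss (v : Bool) : ℝ := if v then 1 else 0

theorem sum_bernProd {K : ℕ} (e : Fin K → ℝ) : ∑ y, bernProd e y = 1 := by
  have := Finset.prod_univ_sum (fun _ : Fin K => (univ : Finset Bool)) (fun j v => bern (e j) v)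
  simp only [sum_bern, prod_const_one, Fintype.piFinset_univ] at this
  exact this.symm

theorem sum_bernProd_mul {K : ℕ} (e : Fin K → ℝ) (a : Fin K) (f : Bool → ℝ) :
    ∑ y, bernProd e y * f (y a) = ∑ v, bern (e a) v * f v := by
  have := Finset.prod_univ_sum (fun _ : Fin K => (univ : Finset Bool))
    (fun j v => bern (e j) v * if j = a then f v else 1)
  rw [Fintype.piFinset_univ] at this
  rw [prod_eq_single a] at this
  · simp only [if_true, prod_mul_distrib, prod_ite_eq', mem_univ] at this
    exact this.symm
  · intro j _ hj
    simp only [hj, if_false, mul_one, sum_bern]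
  · simp

theorem sum_bernProd_policyLoss {K : ℕ} (e : Fin K → ℝ) (p : Policy K) :
    ∑ y, bernProd e y * policyLoss p (fun j => bitLoss (y j)) = policyLoss p e := by
  unfold policyLoss
  simp only [mul_sum]
  rw [sum_comm]
  refine sum_congr rfl fun j _ => ?_
  have := sum_bernProd_mul e j (fun v => p j * bitLoss v)
  rw [this]
  simp [bern, bitLoss, mul_comm]

theorem sum_bernSeq_succ {K n : ℕ} (e : Fin K → ℝ) (F : (Fin (n + 1) → Fin K → Bool) → ℝ) :
    ∑ b, bernSeq e b * F b = ∑ y, bernProd e y *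
      ∑ b : Fin n → Fin K → Bool, bernSeq e b * F (Fin.cons y b : Fin (n + 1) → Fin K → Bool) := by
  rw [← (Fin.consEquiv fun _ : Fin (n + 1) => Fin K → Bool).sum_comp, Fintype.sum_prod_type]
  refine sum_congr rfl fun y _ => ?_
  rw [mul_sum]
  refine sum_congr rfl fun b _ => ?_
  simp only [Fin.consEquiv, Equiv.coe_fn_mk, bernSeq, Fin.prod_univ_succ, Fin.cons_zero, Fin.cons_succ]
  ring

theorem sum_bernSeq {K : ℕ} (e : Fin K → ℝ) :
    ∀ n : ℕ, ∑ b : Fin n → Fin K → Bool, bernSeq e b = 1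
  | 0 => by simp [bernSeq]
  | n + 1 => by
    have := sum_bernSeq_succ (n := n) e (fun _ => 1)
    simp only [mul_one, sum_bernSeq e n, sum_bernProd] at this
    exact this

theorem sum_bernSeq_policyLoss {K : ℕ} (e : Fin K → ℝ) (p : Policy K) :
    ∀ n : ℕ, ∑ b : Fin n → Fin K → Bool,
      bernSeq e b * ∑ t, policyLoss p (fun j => bitLoss (b t j)) = n * policyLoss p e
  | 0 => by simp
  | n + 1 => by
    rw [sum_bernSeq_succ]
    simp only [Fin.sum_univ_succ, Fin.cons_zero, Fin.cons_succ, mul_add, sum_add_distrib,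
      sum_bernSeq_policyLoss e p n, ← sum_mul, sum_bernSeq, one_mul, sum_bernProd,
      sum_bernProd_policyLoss]
    push_cast
    ring

theorem bernSeq_nonneg {K n : ℕ} {e : Fin K → ℝ} (he : ∀ j, e j ∈ Set.Icc (0 : ℝ) 1)
    (b : Fin n → Fin K → Bool) : 0 ≤ bernSeq e b :=
  prod_nonneg fun _ _ => prod_nonneg fun j _ => bern_nonneg (he j) _

/-- The loss sequence given by bits. -/
def bitSeq {K n : ℕ} (b : Fin n → Fin K → Bool) : Fin n → Fin K → ℝ := fun t j => bitLoss (b t j)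

/-- The expected loss of an algorithm when the losses are independent Bernoulli with means `e`. -/
noncomputable def stochLoss {N K : ℕ} (Θ : Fin N → Policy K) (n : ℕ) (e : Fin K → ℝ)
    (alg : Algorithm N K) : ℝ :=
  ∑ b : Fin n → Fin K → Bool, bernSeq e b * expLoss Θ alg (bitSeq b)

/-- The continuation depends on the first loss vector only through the bit of the drawn action, so
the other bits integrate out. -/
theorem stochLoss_succ {N K : ℕ} (Θ : Fin N → Policy K) (n : ℕ) (e : Fin K → ℝ)
    (alg : Algorithm N K) :
    stochLoss Θ (n + 1) e alg = ∑ i, alg 0 Fin.elim0 i * (policyLoss (Θ i) e +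
      ∑ a, Θ i a * ∑ v, bern (e a) v * stochLoss Θ n e (alg.shift (i, a, bitLoss v))) := by
  unfold stochLoss
  rw [sum_bernSeq_succ]
  have h1 : ∀ (y : Fin K → Bool) (b : Fin n → Fin K → Bool),
      expLoss Θ alg (bitSeq (Fin.cons y b : Fin (n + 1) → Fin K → Bool)) =
      ∑ i, ∑ a, alg 0 Fin.elim0 i * Θ i a * (policyLoss (Θ i) (fun j => bitLoss (y j)) +
        expLoss Θ (alg.shift (i, a, bitLoss (y a))) (bitSeq b)) := by
    intro y b
    rw [expLoss_succ]
    rfl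
  have h2 : ∀ y : Fin K → Bool, ∑ b : Fin n → Fin K → Bool, bernSeq e b *
      expLoss Θ alg (bitSeq (Fin.cons y b : Fin (n + 1) → Fin K → Bool)) =
      ∑ i, ∑ a, alg 0 Fin.elim0 i * Θ i a * (policyLoss (Θ i) (fun j => bitLoss (y j)) +
        stochLoss Θ n e (alg.shift (i, a, bitLoss (y a)))) := by
    intro y
    simp only [h1, mul_sum]
    rw [sum_comm]
    refine sum_congr rfl fun i _ => ?_
    rw [sum_comm]
    refine sum_congr rfl fun a _ => ?_
    have : ∀ b : Fin n → Fin K → Bool, bernSeq e b * (alg 0 Fin.elim0 i * Θ i a *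
        (policyLoss (Θ i) (fun j => bitLoss (y j)) +
          expLoss Θ (alg.shift (i, a, bitLoss (y a))) (bitSeq b))) =
        alg 0 Fin.elim0 i * Θ i a * (bernSeq e b * policyLoss (Θ i) (fun j => bitLoss (y j)) +
          bernSeq e b * expLoss Θ (alg.shift (i, a, bitLoss (y a))) (bitSeq b)) := fun b => by ring
    simp only [this]
    rw [← mul_sum, sum_add_distrib, ← sum_mul, sum_bernSeq, one_mul, stochLoss]
  simp only [h2]
  rw [sum_congr rfl fun y _ => mul_sum univ _ (bernProd e y), sum_comm]
  refine sum_congr rfl fun i _ => ?_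
  rw [sum_congr rfl fun y _ => mul_sum univ _ (bernProd e y), sum_comm]
  have h3 : ∀ a, ∑ y, bernProd e y * (alg 0 Fin.elim0 i * Θ i a *
      (policyLoss (Θ i) (fun j => bitLoss (y j)) +
        stochLoss Θ n e (alg.shift (i, a, bitLoss (y a))))) =
      alg 0 Fin.elim0 i * (Θ i a * policyLoss (Θ i) e + Θ i a *
        ∑ v, bern (e a) v * stochLoss Θ n e (alg.shift (i, a, bitLoss v))) := by
    intro a
    have : ∀ y, bernProd e y * (alg 0 Fin.elim0 i * Θ i a *
        (policyLoss (Θ i) (fun j => bitLoss (y j)) +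
          stochLoss Θ n e (alg.shift (i, a, bitLoss (y a))))) =
        alg 0 Fin.elim0 i * Θ i a * (bernProd e y * policyLoss (Θ i) (fun j => bitLoss (y j)) +
          bernProd e y * stochLoss Θ n e (alg.shift (i, a, bitLoss (y a)))) := fun y => by ring
    simp only [this]
    rw [← mul_sum, sum_add_distrib, sum_bernProd_policyLoss,
      sum_bernProd_mul e a (fun v => stochLoss Θ n e (alg.shift (i, a, bitLoss v)))]
    ring
  simp only [h3]
  have hΘ : ∑ a, Θ i a = 1 := (Θ i).2.2
  rw [← mul_sum, sum_add_distrib, ← sum_mul, hΘ, one_mul]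
  rfl

/-! ### Indistinguishability of two environments. -/

/-- If `a` is the minimum, the difference of the two sides is `(5√a - 3√b)² / 16`. -/
theorem mul_sqrt_sub_le_min {a b : ℝ} (ha : 0 ≤ a) (hb : 0 ≤ b) :
    15 / 8 * √(a * b) - 9 / 16 * (a + b) ≤ min a b := by
  rw [Real.sqrt_mul ha]
  have h1 := Real.sq_sqrt ha
  have h2 := Real.sq_sqrt hb
  rcases min_choice a b with h | h <;> rw [h]
  · nlinarith [sq_nonneg (5 * √a - 3 * √b)]
  · nlinarith [sq_nonneg (3 * √a - 5 * √b)]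

/-- In two Bernoulli environments in which different policies are better by `g`, the weighted
expected regrets cannot both be small: `ρ` bounds the Bhattacharyya affinity of the observations
in one round. -/
theorem stochLoss_add_stochLoss_ge {K : ℕ} (Θ : Fin 2 → Policy K) {e f : Fin K → ℝ} {g ρ : ℝ}
    (he : ∀ j, e j ∈ Set.Icc (0 : ℝ) 1) (hf : ∀ j, f j ∈ Set.Icc (0 : ℝ) 1)
    (hg : 0 ≤ g) (hρ : 0 ≤ ρ)
    (hge : policyLoss (Θ 1) e = policyLoss (Θ 0) e + g)
    (hgf : policyLoss (Θ 0) f = policyLoss (Θ 1) f + g)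
    (hA : ∀ i, ρ ≤ ∑ a, Θ i a * ∑ v, √(bern (e a) v * bern (f a) v)) :
    ∀ (n : ℕ) (alg : Algorithm 2 K) (α β : ℝ), 0 ≤ α → 0 ≤ β →
      g * (15 / 8 * √(α * β) * ∑ k ∈ range n, ρ ^ k - 9 / 16 * n * (α + β)) ≤
        α * (stochLoss Θ n e alg - n * policyLoss (Θ 0) e) +
        β * (stochLoss Θ n f alg - n * policyLoss (Θ 1) f)
  | 0, alg, α, β, hα, hβ => by simp [stochLoss, expLoss]
  | n + 1, alg, α, β, hα, hβ => by
    set S := ∑ k ∈ range n, ρ ^ k with hS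
    have hS0 : 0 ≤ S := sum_nonneg fun k _ => pow_nonneg hρ k
    set w : Fin 2 → ℝ := fun i => alg 0 Fin.elim0 i with hw
    have hw0 : ∀ i, 0 ≤ w i := fun i => (alg 0 Fin.elim0).2.1 i
    have hw1 : w 0 + w 1 = 1 := by
      have := (alg 0 Fin.elim0).2.2
      rwa [Fin.sum_univ_two] at this
    have hround : ∀ i, g * (15 / 8 * √(α * β) * (ρ * S) - 9 / 16 * n * (α + β)) ≤
        α * (∑ a, Θ i a * ∑ v, bern (e a) v * stochLoss Θ n e (alg.shift (i, a, bitLoss v))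
          - n * policyLoss (Θ 0) e) +
        β * (∑ a, Θ i a * ∑ v, bern (f a) v * stochLoss Θ n f (alg.shift (i, a, bitLoss v))
          - n * policyLoss (Θ 1) f) := by
      intro i
      have hΘ1 : ∑ a, Θ i a = 1 := (Θ i).2.2
      have hΘ0 : ∀ a, 0 ≤ Θ i a := (Θ i).2.1
      -- Induction with the weights multiplied by the likelihoods of the observed bit.
      have ih : ∀ a v, g * (15 / 8 * (√(α * β) * √(bern (e a) v * bern (f a) v)) * S
            - 9 / 16 * n * (α * bern (e a) v + β * bern (f a) v)) ≤
          α * bern (e a) v * (stochLoss Θ n e (alg.shift (i, a, bitLoss v))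
            - n * policyLoss (Θ 0) e) +
          β * bern (f a) v * (stochLoss Θ n f (alg.shift (i, a, bitLoss v))
            - n * policyLoss (Θ 1) f) := by
        intro a v
        have := stochLoss_add_stochLoss_ge Θ he hf hg hρ hge hgf hA n
          (alg.shift (i, a, bitLoss v)) (α * bern (e a) v) (β * bern (f a) v)
          (mul_nonneg hα (bern_nonneg (he a) v)) (mul_nonneg hβ (bern_nonneg (hf a) v))
        rwa [mul_mul_mul_comm, Real.sqrt_mul (mul_nonneg hα hβ)] at this
      have hact : ∀ a, g * (15 / 8 * √(α * β) * S * (∑ v, √(bern (e a) v * bern (f a) v))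
            - 9 / 16 * n * (α + β)) ≤
          α * (∑ v, bern (e a) v * stochLoss Θ n e (alg.shift (i, a, bitLoss v))
            - n * policyLoss (Θ 0) e) +
          β * (∑ v, bern (f a) v * stochLoss Θ n f (alg.shift (i, a, bitLoss v))
            - n * policyLoss (Θ 1) f) := by
        intro a
        have h1 := ih a true
        have h2 := ih a false
        simp only [Fintype.sum_bool]
        simp only [bern, if_true, Bool.false_eq_true, if_false] at h1 h2 ⊢
        linarith
      have hsum := sum_le_sum fun a (_ : a ∈ univ) => mul_le_mul_of_nonneg_left (hact a) (hΘ0 a)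
      have hl : ∑ a, Θ i a * (g * (15 / 8 * √(α * β) * S * (∑ v, √(bern (e a) v * bern (f a) v))
            - 9 / 16 * n * (α + β))) =
          g * (15 / 8 * √(α * β) * S * (∑ a, Θ i a * ∑ v, √(bern (e a) v * bern (f a) v))
            - 9 / 16 * n * (α + β)) := by
        have : ∀ a, Θ i a * (g * (15 / 8 * √(α * β) * S *
              (∑ v, √(bern (e a) v * bern (f a) v)) - 9 / 16 * n * (α + β))) =
            g * (15 / 8 * √(α * β) * S) * (Θ i a * ∑ v, √(bern (e a) v * bern (f a) v))
            - Θ i a * (g * (9 / 16 * n * (α + β))) := fun a => by ring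
        simp only [this]
        rw [sum_sub_distrib, ← mul_sum, ← sum_mul, hΘ1]
        ring
      have hr : ∀ X Y : Fin K → ℝ, ∀ x y : ℝ,
          ∑ a, Θ i a * (α * (X a - x) + β * (Y a - y)) =
          α * (∑ a, Θ i a * X a - x) + β * (∑ a, Θ i a * Y a - y) := by
        intro X Y x y
        have : ∀ a, Θ i a * (α * (X a - x) + β * (Y a - y)) =
            α * (Θ i a * X a) + β * (Θ i a * Y a) - Θ i a * (α * x + β * y) := fun a => by ring
        simp only [this]
        rw [sum_sub_distrib, sum_add_distrib, ← mul_sum, ← mul_sum, ← sum_mul, hΘ1]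
        ring
      rw [hl, hr] at hsum
      refine le_trans ?_ hsum
      have : √(α * β) * S * ρ ≤
          √(α * β) * S * (∑ a, Θ i a * ∑ v, √(bern (e a) v * bern (f a) v)) :=
        mul_le_mul_of_nonneg_left (hA i) (mul_nonneg (Real.sqrt_nonneg _) hS0)
      refine mul_le_mul_of_nonneg_left ?_ hg
      linarith
    -- The right side is the weighted regret of the current round: policy 1 is the mistake under
    -- `e`, policy 0 under `f`.
    have hmin : g * (15 / 8 * √(α * β) - 9 / 16 * (α + β)) ≤ g * (α * w 1 + β * w 0) := by
      refine mul_le_mul_of_nonneg_left ((mul_sqrt_sub_le_min hα hβ).trans ?_) hg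
      have h1 := mul_le_mul_of_nonneg_right (min_le_left α β) (hw0 1)
      have h2 := mul_le_mul_of_nonneg_right (min_le_right α β) (hw0 0)
      have h3 : min α β * w 1 + min α β * w 0 = min α β := by
        rw [← mul_add, add_comm, hw1, mul_one]
      linarith
    have hgeom : ∑ k ∈ range (n + 1), ρ ^ k = ρ * S + 1 := by
      rw [sum_range_succ', hS, mul_sum]
      simp [pow_succ']
    rw [hgeom, stochLoss_succ, stochLoss_succ, Fin.sum_univ_two, Fin.sum_univ_two]
    have h0 := mul_le_mul_of_nonneg_left (hround 0) (hw0 0)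
    have h1 := mul_le_mul_of_nonneg_left (hround 1) (hw0 1)
    change _ ≤ α * (w 0 * _ + w 1 * _ - _) + β * (w 0 * _ + w 1 * _ - _)
    rw [hge, hgf]
    have hw0' : w 0 = 1 - w 1 := by linarith
    rw [hw0'] at h0 hmin ⊢
    push_cast
    linarith

/-! ### From random losses to a fixed sequence. -/

/-- Regret against the best policy in hindsight dominates regret against a fixed one, and the worst
bit sequence dominates both averages. -/
theorem exists_regret_ge {K n : ℕ} (Θ : Fin 2 → Policy K) (alg : Algorithm 2 K)
    {e f : Fin K → ℝ} (he : ∀ j, e j ∈ Set.Icc (0 : ℝ) 1) (hf : ∀ j, f j ∈ Set.Icc (0 : ℝ) 1)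
    {R : ℝ} (hR : 2 * R ≤ (stochLoss Θ n e alg - n * policyLoss (Θ 0) e) +
      (stochLoss Θ n f alg - n * policyLoss (Θ 1) f)) :
    ∃ ℓ : Fin n → Fin K → ℝ, (∀ t j, ℓ t j ∈ Set.Icc (0 : ℝ) 1) ∧ R ≤ regret Θ alg ℓ := by
  have havg : ∀ (u : Fin K → ℝ) (i : Fin 2), (∀ j, u j ∈ Set.Icc (0 : ℝ) 1) →
      stochLoss Θ n u alg - n * policyLoss (Θ i) u ≤
        ∑ b : Fin n → Fin K → Bool, bernSeq u b * regret Θ alg (bitSeq b) := by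
    intro u i hu
    rw [stochLoss, ← sum_bernSeq_policyLoss, ← sum_sub_distrib]
    refine sum_le_sum fun b _ => ?_
    rw [← mul_sub]
    refine mul_le_mul_of_nonneg_left (sub_le_sub_left ?_ _) (bernSeq_nonneg hu b)
    exact inf'_le (fun i : Fin 2 => ∑ t, policyLoss (Θ i) (bitSeq b t)) (mem_univ i)
  by_contra! hlt
  have hub : ∀ b : Fin n → Fin K → Bool, regret Θ alg (bitSeq b) < R := fun b =>
    hlt (bitSeq b) fun t j => by
      unfold bitSeq bitLoss
      split <;> simp
  obtain ⟨b₀, -, hb₀⟩ := exists_max_image (univ : Finset (Fin n → Fin K → Bool))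
    (fun b => regret Θ alg (bitSeq b)) univ_nonempty
  have hle : ∀ (u : Fin K → ℝ), (∀ j, u j ∈ Set.Icc (0 : ℝ) 1) →
      ∑ b : Fin n → Fin K → Bool, bernSeq u b * regret Θ alg (bitSeq b) ≤
        regret Θ alg (bitSeq b₀) := by
    intro u hu
    calc _ ≤ ∑ b : Fin n → Fin K → Bool, bernSeq u b * regret Θ alg (bitSeq b₀) :=
          sum_le_sum fun b _ =>
            mul_le_mul_of_nonneg_left (hb₀ b (mem_univ b)) (bernSeq_nonneg hu b)
      _ = _ := by rw [← sum_mul, sum_bernSeq, one_mul]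
  linarith [havg e 0 he, havg f 1 hf, hle e he, hle f hf, hub b₀]

/-! ### Separation and information in the Hellinger direction. -/

/-- The direction in which the losses separate two policies at the least information cost. -/
noncomputable def hellingerDir {K : ℕ} (p q : Policy K) (j : Fin K) : ℝ :=
  (√(p j) - √(q j)) / (√(p j) + √(q j))

theorem hellingerDir_comm {K : ℕ} (p q : Policy K) (j : Fin K) :
    hellingerDir q p j = -hellingerDir p q j := by
  unfold hellingerDir
  rw [add_comm, ← neg_div, neg_sub]

theorem sqHellinger_comm {K : ℕ} (p q : Policy K) : sqHellinger q p = sqHellinger p q := by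
  unfold sqHellinger
  congr 1
  exact sum_congr rfl fun j _ => by ring

theorem sq_hellingerDir_le_one {K : ℕ} (p q : Policy K) (j : Fin K) :
    hellingerDir p q j ^ 2 ≤ 1 := by
  unfold hellingerDir
  have hp := Real.sqrt_nonneg (p j)
  have hq := Real.sqrt_nonneg (q j)
  rw [div_pow]
  exact div_le_one_of_le₀ (by nlinarith [mul_nonneg hp hq]) (sq_nonneg _)

theorem policyLoss_hellingerDir_sub {K : ℕ} (p q : Policy K) :
    policyLoss p (hellingerDir p q) - policyLoss q (hellingerDir p q) = 2 * sqHellinger p q := by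
  unfold policyLoss sqHellinger hellingerDir
  rw [← sum_sub_distrib, ← mul_assoc, mul_one_div_cancel two_ne_zero, one_mul]
  refine sum_congr rfl fun j _ => ?_
  have hp := Real.sq_sqrt (p.2.1 j)
  have hq := Real.sq_sqrt (q.2.1 j)
  have hp0 := Real.sqrt_nonneg (p j)
  have hq0 := Real.sqrt_nonneg (q j)
  rw [← sub_mul]
  -- If both masses vanish, the quotient is `0 / 0 = 0` and both sides are zero.
  rcases (add_nonneg hp0 hq0).eq_or_lt with h | h
  · have h1 : √(p j) = 0 := by linarith
    have h2 : √(q j) = 0 := by linarith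
    simp [h1, h2]
  · change √(p j) ^ 2 = p j at hp
    change √(q j) ^ 2 = q j at hq
    rw [mul_div_assoc', div_eq_iff h.ne']
    nth_rewrite 1 [← hp]
    nth_rewrite 1 [← hq]
    ring

theorem sum_mul_sq_hellingerDir_le {K : ℕ} (p q : Policy K) :
    ∑ j, p j * hellingerDir p q j ^ 2 ≤ 2 * sqHellinger p q := by
  unfold sqHellinger hellingerDir
  rw [← mul_assoc, mul_one_div_cancel two_ne_zero, one_mul]
  refine sum_le_sum fun j _ => ?_
  have hp : √(p j) ^ 2 = p j := Real.sq_sqrt (p.2.1 j)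
  have hp0 := Real.sqrt_nonneg (p j)
  have hq0 := Real.sqrt_nonneg (q j)
  rw [div_pow, mul_div_assoc']
  refine div_le_of_le_mul₀ (sq_nonneg _) (sq_nonneg _) ?_
  rw [mul_comm]
  refine mul_le_mul_of_nonneg_left ?_ (sq_nonneg _)
  nlinarith [mul_nonneg hp0 hq0]

/-- The affinity equals `√(1 - 4x²)`; after squaring, the claim is `81/16 x⁴ ≤ x²/2`, which is
exactly `hx` when `x ≠ 0`. -/
theorem sum_sqrt_bern_ge {x : ℝ} (hx : 4 * x ^ 2 ≤ 32 / 81) :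
    1 - 9 / 4 * x ^ 2 ≤ ∑ v, √(bern (1 / 2 - x) v * bern (1 / 2 + x) v) := by
  have h : ∑ v, √(bern (1 / 2 - x) v * bern (1 / 2 + x) v) = √(1 - 4 * x ^ 2) := by
    simp only [Fintype.sum_bool, bern, if_true, Bool.false_eq_true, if_false]
    rw [show (1 / 2 - x) * (1 / 2 + x) = (1 - 4 * x ^ 2) / 2 ^ 2 by ring,
      show (1 - (1 / 2 - x)) * (1 - (1 / 2 + x)) = (1 - 4 * x ^ 2) / 2 ^ 2 by ring,
      Real.sqrt_div' _ (by norm_num), Real.sqrt_sq (by norm_num)]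
    ring
  rw [h]
  refine Real.le_sqrt_of_sq_le ?_
  nlinarith [mul_nonneg (sq_nonneg x) (sub_nonneg.2 hx)]

theorem policyLoss_half_add {K : ℕ} (p : Policy K) (δ : ℝ) (c : Fin K → ℝ) :
    policyLoss p (fun j => 1 / 2 + δ * c j) = 1 / 2 + δ * policyLoss p c := by
  have h1 : ∑ j, p j = 1 := p.2.2
  unfold policyLoss
  simp only [mul_add, sum_add_distrib, ← sum_mul, h1, mul_sum]
  rw [one_mul]
  congr 1
  exact sum_congr rfl fun j _ => by ring

end FixedExpertBandit

/-! ### Choice of the constants. -/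

open FixedExpertBandit in
theorem theorem6 {K : ℕ} (θ₁ θ₂ : FixedExpertBandit.Policy K)
    (hH : 0 < FixedExpertBandit.sqHellinger θ₁ θ₂)
    (T : ℕ)
    (hT : 1 / (8 * Real.log (4 / 3) * FixedExpertBandit.sqHellinger θ₁ θ₂) ≤ (T : ℝ))
    (alg : FixedExpertBandit.Algorithm 2 K) :
    ∃ ℓ : Fin T → Fin K → ℝ, (∀ t j, ℓ t j ∈ Set.Icc (0 : ℝ) 1) ∧
      1 / 13 * √(FixedExpertBandit.sqHellinger θ₁ θ₂ * (T : ℝ)) ≤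
        FixedExpertBandit.regret ![θ₁, θ₂] alg ℓ := by
  set h := sqHellinger θ₁ θ₂ with hh
  have hlog0 : 0 < Real.log (4 / 3) := Real.log_pos (by norm_num)
  have hlog1 : Real.log (4 / 3) ≤ 1 / 3 := by
    have := Real.log_le_sub_one_of_pos (show (0 : ℝ) < 4 / 3 by norm_num)
    linarith
  have hhT : 3 / 8 ≤ h * T := by
    rw [div_le_iff₀ (by positivity)] at hT
    have : (0 : ℝ) ≤ T * h := by positivity
    nlinarith [mul_le_mul_of_nonneg_left hlog1 this]
  have hTpos : (0 : ℝ) < T := by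
    rcases (Nat.cast_nonneg (α := ℝ) T).eq_or_lt with h0 | h0
    · rw [← h0] at hhT; norm_num at hhT
    · exact h0
  have hT1 : (1 : ℝ) ≤ T := by exact_mod_cast Nat.cast_pos.1 hTpos
  set u := √(h * T) with hu
  have hu2 : u ^ 2 = h * T := Real.sq_sqrt (by positivity)
  have hu0 : 0 < u := Real.sqrt_pos.2 (by positivity)
  -- This makes the affinity deficit `9/4 * δ² * 2h` equal to `1/(8T)`.
  set δ := 1 / (6 * u) with hδ
  have hδ0 : 0 < δ := by positivity
  have hδu : δ * u = 1 / 6 := by rw [hδ]; field_simp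
  have hδ2 : δ ^ 2 * (h * T) = 1 / 36 := by rw [← hu2, ← mul_pow, hδu]; norm_num
  have hδle : δ ^ 2 ≤ 2 / 27 := by nlinarith [sq_nonneg δ]
  set c := hellingerDir θ₁ θ₂ with hc
  have hc1 : ∀ j, c j ^ 2 ≤ 1 := sq_hellingerDir_le_one θ₁ θ₂
  have hx : ∀ j, (δ * c j) ^ 2 ≤ 2 / 27 := fun j => by
    rw [mul_pow]; nlinarith [hc1 j, sq_nonneg δ, sq_nonneg (c j)]
  have hxb : ∀ j, |δ * c j| ≤ 1 / 2 := fun j => abs_le_of_sq_le_sq (by linarith [hx j]) (by norm_num)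
  set e : Fin K → ℝ := fun j => 1 / 2 + (-δ) * c j with he
  set f : Fin K → ℝ := fun j => 1 / 2 + δ * c j with hf
  have he01 : ∀ j, e j ∈ Set.Icc (0 : ℝ) 1 := fun j => by
    have := abs_le.1 (hxb j)
    constructor <;> simp only [he] <;> linarith
  have hf01 : ∀ j, f j ∈ Set.Icc (0 : ℝ) 1 := fun j => by
    have := abs_le.1 (hxb j)
    constructor <;> simp only [hf] <;> linarith
  have hgap := policyLoss_hellingerDir_sub θ₁ θ₂
  rw [← hc, ← hh] at hgap
  have hρ : ∀ p : Policy K, ∑ j, p j * c j ^ 2 ≤ 2 * h →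
      1 - 1 / (8 * T) ≤ ∑ a, p a * ∑ v, √(bern (e a) v * bern (f a) v) := by
    intro p hp
    have hp1 : ∑ j, p j = 1 := p.2.2
    calc (1 : ℝ) - 1 / (8 * T) = 1 - 9 / 4 * δ ^ 2 * (2 * h) := by
          have : δ ^ 2 * h = 1 / (36 * T) := by
            rw [eq_div_iff (by positivity)]; linarith
          rw [mul_assoc, show δ ^ 2 * (2 * h) = 2 * (δ ^ 2 * h) by ring, this]
          field_simp
          ring
      _ ≤ 1 - 9 / 4 * δ ^ 2 * ∑ j, p j * c j ^ 2 := by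
          have := mul_le_mul_of_nonneg_left hp (show 0 ≤ 9 / 4 * δ ^ 2 by positivity)
          linarith
      _ = ∑ j, p j * (1 - 9 / 4 * (δ * c j) ^ 2) := by
          simp only [mul_sub, Finset.sum_sub_distrib, mul_one, hp1, Finset.mul_sum]
          congr 1
          exact Finset.sum_congr rfl fun j _ => by ring
      _ ≤ _ := by
          refine Finset.sum_le_sum fun j _ => mul_le_mul_of_nonneg_left ?_ (p.2.1 j)
          have := sum_sqrt_bern_ge (x := δ * c j) (by linarith [hx j])
          simpa only [he, hf, neg_mul, ← sub_eq_add_neg] using this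
  have hinv : 1 / (8 * (T : ℝ)) ≤ 1 / 8 := by
    rw [div_le_div_iff₀ (by positivity) (by norm_num)]; linarith
  have hmain := stochLoss_add_stochLoss_ge ![θ₁, θ₂] he01 hf01 (g := δ * (2 * h))
    (ρ := 1 - 1 / (8 * T)) (by positivity) (by linarith)
    (by
      simp only [Matrix.cons_val_zero, Matrix.cons_val_one, he, policyLoss_half_add, ← hgap]
      ring)
    (by
      simp only [Matrix.cons_val_zero, Matrix.cons_val_one, hf, policyLoss_half_add, ← hgap]
      ring)
    (by
      intro i
      fin_cases i
      · exact hρ θ₁ (sum_mul_sq_hellingerDir_le θ₁ θ₂)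
      · refine hρ θ₂ ?_
        have := sum_mul_sq_hellingerDir_le θ₂ θ₁
        simpa only [hellingerDir_comm θ₁ θ₂, sqHellinger_comm θ₁ θ₂, neg_sq] using this)
    T alg 1 1 zero_le_one zero_le_one
  -- By Bernoulli's inequality each term is at least `1 - k/(8T) ≥ 7/8`.
  have hgeom : 7 / 8 * (T : ℝ) ≤ ∑ k ∈ Finset.range T, (1 - 1 / (8 * (T : ℝ))) ^ k := by
    have hk : ∀ k ∈ Finset.range T, (7 / 8 : ℝ) ≤ (1 - 1 / (8 * (T : ℝ))) ^ k := by
      intro k hk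
      have hkT : (k : ℝ) ≤ T := by exact_mod_cast (Finset.mem_range.1 hk).le
      have h1 := one_add_mul_le_pow (a := -(1 / (8 * (T : ℝ)))) (by linarith) k
      rw [← sub_eq_add_neg] at h1
      have h2 : (k : ℝ) * (1 / (8 * T)) ≤ 1 / 8 := by
        rw [mul_one_div, div_le_div_iff₀ (by positivity) (by norm_num)]; linarith
      linarith
    have := Finset.card_nsmul_le_sum _ _ _ hk
    rw [Finset.card_range, nsmul_eq_mul] at this
    linarith
  refine exists_regret_ge ![θ₁, θ₂] alg he01 hf01 ?_
  rw [mul_one, Real.sqrt_one, one_mul, one_mul] at hmain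
  refine le_trans ?_ hmain
  -- `15/8 * 7/8 - 9/8 = 33/64`; halving the resulting `33/192 * u` still leaves more than `u/13`.
  have h3 : δ * (2 * h) * (33 / 64 * T) ≤ δ * (2 * h) *
      (15 / 8 * 1 * ∑ k ∈ Finset.range T, (1 - 1 / (8 * (T : ℝ))) ^ k
        - 9 / 16 * T * (1 + 1)) :=
    mul_le_mul_of_nonneg_left (by linarith) (by positivity)
  refine le_trans ?_ h3
  have h4 : δ * (2 * h) * (33 / 64 * T) = 33 / 192 * u := by
    calc _ = 33 / 32 * (δ * (h * T)) := by ring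
      _ = 33 / 32 * ((δ * u) * u) := by rw [← hu2]; ring
      _ = _ := by rw [hδu]; ring
  rw [h4]
  linarith
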